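/- All graphs are finite and simple. A graph $G$ is called $r$-critical if $\chi(G)=r$ and every proper subgraph of $G$ has chromatic number less than $r$. Adding a simplicial vertex to a graph means adding one new vertex adjacent to all existing vertices. Let $M$ be the Moser spindle, i.e. the graph on $\{0,\dots,6\}$ with the $11$ edges $01,02,12,15,25,03,04,34,36,46,56$, and let $S$ be the graph on $\{0,\dots,6\}$ with the $12$ edges $01,02,12,03,13,04,24,15,25,36,46,56$. The graphs $M$ and $S$ are not isomorphic, and, up to isomorphism, they are precisely the $4$-critical graphs on seven vertices. For every integer $r\ge 8$ there are, up to isomorphism, precisely two $r$-critical graphs on $r+3$ vertices: the graph obtained from $M$ by adding $r-4$ simplicial vertices, i.e. the join $M\vee K_{r-4}$, and the graph obtained from $S$ by adding $r-4$ simplicial vertices, i.e. the join $S\vee K_{r-4}$. -/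

import Mathlib

namespace SimpleGraph

/-- `G` is `r`-critical: its chromatic number is `r`, and every proper subgraph (obtained by
deleting vertices, edges, or both) has chromatic number less than `r`. -/
def IsColorCritical {V : Type*} (G : SimpleGraph V) (r : ℕ) : Prop :=
  G.chromaticNumber = r ∧ ∀ H : G.Subgraph, H ≠ ⊤ → H.coe.chromaticNumber < r

/-- The join of two graphs: their disjoint union together with all edges between them. -/
def joinGraph {V W : Type*} (G : SimpleGraph V) (H : SimpleGraph W) : SimpleGraph (V ⊕ W) :=
  (G ⊕g H) ⊔ completeBipartiteGraph V W

/-- The graph obtained from `G` by adding `k` new vertices one after another, each adjacent to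
all the vertices present; that is, the join of `G` with the complete graph on `k` vertices. -/
def addSimplicial {V : Type*} (G : SimpleGraph V) (k : ℕ) : SimpleGraph (V ⊕ Fin k) :=
  G.joinGraph (completeGraph (Fin k))

/-- The Moser spindle, with `11` edges: the rhombi `0,1,5,2` and `0,3,6,4` (each with its short
diagonal `12`, `34`) share the vertex `0`, and their opposite corners `5`, `6` are adjacent. -/
def moserSpindle : SimpleGraph (Fin 7) :=
  fromEdgeSet {s(0, 1), s(0, 2), s(1, 2), s(1, 5), s(2, 5),
    s(0, 3), s(0, 4), s(3, 4), s(3, 6), s(4, 6), s(5, 6)}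

/-- The triangle `0,1,2` with a further triangle erected on each of its sides (with apexes
`3`, `4`, `5`), and a vertex `6` adjacent to the three apexes; it has `12` edges. -/
def cappedSun : SimpleGraph (Fin 7) :=
  fromEdgeSet {s(0, 1), s(0, 2), s(1, 2), s(3, 0), s(3, 1), s(4, 0), s(4, 2),
    s(5, 1), s(5, 2), s(6, 3), s(6, 4), s(6, 5)}

end SimpleGraph

/-!
Let `G` be `(k + 4)`-critical on `k + 7` vertices. A matching of the complement with few unmatched
vertices is a colouring of `G` with few colours, so the Tutte barrier of a maximum matching has many
odd components. Complement degrees are at most 3, and no neighbourhood in `G` contains another, so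
small odd components are either isolated or send at least two edges to the barrier. Counting weights
over the odd components leaves at most 7 vertices of `G` that are not adjacent to all others.

Hence `G` contains a non-3-colourable graph on 7 vertices joined with a clique on the other `k`.
A non-3-colourable graph on 7 vertices contains `K₄`, the 5-wheel, the capped sun or the Moser
spindle. If it has an independent triple, the other four vertices contain a triangle; since no
3-colouring of these four extends to the triple, one of the first three graphs appears. If not, the
complement is triangle-free and contains a cycle of length 5 or 7, and the Moser spindle is found
around this cycle. Joining with a clique preserves criticality, and criticality of `G` turns
containment into isomorphism, which excludes `K₄` and the 5-wheel by their order.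
-/

namespace ColorCritical

open SimpleGraph

section Coloring

variable {V α : Type*} {G : SimpleGraph V} {k n : ℕ}

lemma nonempty_coloring_of_isIndepSet {S : Set V} (hS : G.IsIndepSet S)
    (c : (G.induce Sᶜ).Coloring α)
    (hc : ∀ v ∈ S, ∃ a, ∀ w : ↥Sᶜ, G.Adj v w → c w ≠ a) : Nonempty (G.Coloring α) := by
  classical
  choose a ha using hc
  refine ⟨Coloring.mk (fun v ↦ if hv : v ∈ S then a v hv else c ⟨v, hv⟩) ?_⟩
  intro v w hvw
  by_cases hv : v ∈ S <;> by_cases hw : w ∈ S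
  · exact absurd hvw (hS hv hw hvw.ne)
  · simpa only [hv, hw, dite_true, dite_false] using (ha v hv ⟨w, hw⟩ hvw).symm
  · simpa only [hv, hw, dite_true, dite_false] using ha w hw ⟨v, hv⟩ hvw.symm
  · simpa only [hv, hw, dite_false] using c.valid (v := ⟨v, hv⟩) (w := ⟨w, hw⟩) hvw

lemma colorable_succ_of_isIndepSet {S : Set V} (hS : G.IsIndepSet S)
    (hc : (G.induce Sᶜ).Colorable n) : G.Colorable (n + 1) := by
  obtain ⟨c⟩ := hc
  refine nonempty_coloring_of_isIndepSet hS
    ((Embedding.completeGraph Fin.castSuccEmb).toHom.comp c)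
    fun v _ ↦ ⟨Fin.last n, fun w _ ↦ (Fin.castSucc_lt_last _).ne⟩

lemma le_degree_of_colorable_induce_compl (hG : ¬ G.Colorable k) {v : V}
    [Fintype (G.neighborSet v)] (hv : (G.induce {v}ᶜ).Colorable k) : k ≤ G.degree v := by
  obtain ⟨c⟩ := hv
  have hall (a : Fin k) : ∃ w : ↥({v}ᶜ : Set V), G.Adj v w ∧ c w = a := by
    by_contra! ha
    refine hG (nonempty_coloring_of_isIndepSet (Set.pairwise_singleton v _) c ?_)
    rintro _ rfl
    exact ⟨a, ha⟩
  choose w hadj hcol using hall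
  let f (a : Fin k) : G.neighborSet v := ⟨w a, hadj a⟩
  have hw : (fun a ↦ (w a : V)).Injective :=
    Subtype.val_injective.comp (Function.LeftInverse.injective hcol)
  have hf : f.Injective := fun a b hab ↦ hw (congrArg (Subtype.val : G.neighborSet v → V) hab)
  simpa only [Fintype.card_fin, card_neighborSet_eq_degree] using
    Fintype.card_le_of_injective f hf

lemma not_neighborSet_subset_of_colorable_induce_compl (hG : ¬ G.Colorable k) {u v : V}
    (huv : u ≠ v) (hu : (G.induce {u}ᶜ).Colorable k) :
    ¬ G.neighborSet u ⊆ G.neighborSet v := by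
  obtain ⟨c⟩ := hu
  refine fun hsub ↦ hG (nonempty_coloring_of_isIndepSet (Set.pairwise_singleton u _) c ?_)
  rintro _ rfl
  exact ⟨c ⟨v, huv.symm⟩, fun w hw ↦ (c.valid (v := ⟨v, huv.symm⟩) (hsub hw)).symm⟩

lemma colorable_add_ncard_compl [Finite V] {s : Set V} (hs : (G.induce s).Colorable n) :
    G.Colorable (n + sᶜ.ncard) := by
  classical
  have := Fintype.ofFinite ↥sᶜ
  obtain ⟨c⟩ := hs
  let d : G.Coloring (Fin n ⊕ ↥sᶜ) :=
    Coloring.mk (fun v ↦ if hv : v ∈ s then .inl (c ⟨v, hv⟩) else .inr ⟨v, hv⟩) <| by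
      intro v w hvw heq
      by_cases hv : v ∈ s <;> by_cases hw : w ∈ s <;> simp only [hv, hw, dite_true, dite_false,
        Sum.inl.injEq, Sum.inr.injEq, Subtype.mk.injEq, reduceCtorEq] at heq
      · exact c.valid (v := ⟨v, hv⟩) (w := ⟨w, hw⟩) hvw heq
      · exact hvw.ne heq
  have hcard : Fintype.card (Fin n ⊕ ↥sᶜ) = n + sᶜ.ncard := by
    rw [Fintype.card_sum, Fintype.card_fin, Fintype.card_eq_nat_card, Nat.card_coe_set_eq]
  exact hcard ▸ d.colorable

end Coloring

section Critical

variable {V W : Type*} {G : SimpleGraph V} {F : SimpleGraph W} {k r : ℕ}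

lemma chromaticNumber_lt_iff_exists_colorable :
    G.chromaticNumber < r ↔ ∃ m < r, G.Colorable m := by
  refine ⟨fun h ↦ ?_, fun ⟨m, hm, hG⟩ ↦ hG.chromaticNumber_le.trans_lt (by exact_mod_cast hm)⟩
  obtain ⟨m, hm⟩ := ENat.ne_top_iff_exists.mp (h.trans_le le_top).ne
  exact ⟨m, by exact_mod_cast hm ▸ h, chromaticNumber_le_iff_colorable.mp hm.ge⟩

lemma chromaticNumber_eq_iff_forall_colorable :
    G.chromaticNumber = r ↔ G.Colorable r ∧ ∀ m, G.Colorable m → r ≤ m := by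
  rw [le_antisymm_iff, chromaticNumber_le_iff_colorable, le_chromaticNumber_iff_colorable]

lemma colorable_of_isColorCritical (h : G.IsColorCritical r) : G.Colorable r :=
  (chromaticNumber_eq_iff_forall_colorable.mp h.1).1

lemma le_of_isColorCritical_of_colorable (h : G.IsColorCritical r) (hG : G.Colorable k) : r ≤ k :=
  (chromaticNumber_eq_iff_forall_colorable.mp h.1).2 k hG

lemma exists_hom_induce_compl_or_deleteEdges {H : G.Subgraph} (hH : H ≠ ⊤) :
    (∃ v, Nonempty (H.coe →g G.induce {v}ᶜ)) ∨
      ∃ a b, G.Adj a b ∧ Nonempty (H.coe →g G.deleteEdges {s(a, b)}) := by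
  by_cases hverts : H.verts = Set.univ
  · obtain ⟨a, b, hab, hHab⟩ : ∃ a b, G.Adj a b ∧ ¬ H.Adj a b := by
      by_contra! hle
      refine hH (top_le_iff.mp ⟨hverts.ge, fun a b hab ↦ hle a b hab⟩)
    refine .inr ⟨a, b, hab, ⟨⟨Subtype.val, fun {x y} hxy ↦ ?_⟩⟩⟩
    refine deleteEdges_adj.mpr ⟨hxy.adj_sub, fun hmem ↦ hHab ?_⟩
    rw [← Subgraph.mem_edgeSet, ← Set.mem_singleton_iff.mp hmem]
    exact hxy
  · obtain ⟨v, hv⟩ := (Set.ne_univ_iff_exists_notMem _).mp hverts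
    exact .inl ⟨v, ⟨⟨fun x ↦ ⟨x, fun h ↦ hv (h ▸ x.2)⟩, fun h ↦ h.adj_sub⟩⟩⟩

theorem isColorCritical_iff :
    G.IsColorCritical r ↔ G.Colorable r ∧ (∀ m, G.Colorable m → r ≤ m) ∧
      (∀ v, ∃ m < r, (G.induce {v}ᶜ).Colorable m) ∧
      ∀ a b, G.Adj a b → ∃ m < r, (G.deleteEdges {s(a, b)}).Colorable m := by
  rw [IsColorCritical, chromaticNumber_eq_iff_forall_colorable, and_assoc]
  simp only [chromaticNumber_lt_iff_exists_colorable]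
  refine and_congr_right fun _ ↦ and_congr_right fun _ ↦
    ⟨fun h ↦ ⟨fun v ↦ ?_, fun a b hab ↦ ?_⟩, ?_⟩
  · have hv : (⊤ : G.Subgraph).induce {v}ᶜ ≠ ⊤ := fun htop ↦
      htop.ge.1 (Set.mem_univ v) rfl
    obtain ⟨m, hm, hc⟩ := h _ hv
    let f : G.induce {v}ᶜ →g ((⊤ : G.Subgraph).induce {v}ᶜ).coe :=
      ⟨fun x ↦ ⟨x, x.2⟩, fun {x y} hxy ↦ ⟨x.2, y.2, hxy⟩⟩
    exact ⟨m, hm, hc.of_hom f⟩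
  · have hab' : (⊤ : G.Subgraph).deleteEdges {s(a, b)} ≠ ⊤ := fun htop ↦
      (htop.ge.2 hab).2 rfl
    obtain ⟨m, hm, hc⟩ := h _ hab'
    let f : G.deleteEdges {s(a, b)} →g ((⊤ : G.Subgraph).deleteEdges {s(a, b)}).coe :=
      ⟨fun x ↦ ⟨x, trivial⟩, fun {x y} hxy ↦ deleteEdges_adj.mp hxy⟩
    exact ⟨m, hm, hc.of_hom f⟩
  · rintro ⟨hvert, hedge⟩ H hH
    rcases exists_hom_induce_compl_or_deleteEdges hH with ⟨v, ⟨f⟩⟩ | ⟨a, b, hab, ⟨f⟩⟩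
    · obtain ⟨m, hm, hc⟩ := hvert v
      exact ⟨m, hm, hc.of_hom f⟩
    · obtain ⟨m, hm, hc⟩ := hedge a b hab
      exact ⟨m, hm, hc.of_hom f⟩

lemma isColorCritical_succ_of_forall_adj (hG : ¬ G.Colorable k) (hvert : ∀ v, ∃ w, G.Adj v w)
    (hedge : ∀ a b, G.Adj a b → (G.deleteEdges {s(a, b)}).Colorable k) :
    G.IsColorCritical (k + 1) := by
  have hdelete (v : V) : (G.induce {v}ᶜ).Colorable k := by
    obtain ⟨w, hvw⟩ := hvert v
    refine (hedge v w hvw).of_hom ⟨Subtype.val, fun {x y} hxy ↦ deleteEdges_adj.mpr ⟨hxy, ?_⟩⟩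
    intro hmem
    have hv : v ∈ s((x : V), (y : V)) := Set.mem_singleton_iff.mp hmem ▸ Sym2.mem_mk_left v w
    exact (Sym2.mem_iff.mp hv).elim (fun h ↦ x.2 h.symm) fun h ↦ y.2 h.symm
  obtain ⟨v⟩ : Nonempty V := not_isEmpty_iff.mp fun _ ↦ hG (.of_isEmpty k)
  exact isColorCritical_iff.mpr ⟨colorable_succ_of_isIndepSet (by simp) (hdelete v),
    fun m hm ↦ Nat.succ_le_of_lt (lt_of_not_ge fun hmk ↦ hG (hm.mono hmk)),
    fun v ↦ ⟨k, k.lt_succ_self, hdelete v⟩, fun a b hab ↦ ⟨k, k.lt_succ_self, hedge a b hab⟩⟩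

lemma isColorCritical_of_iso (e : G ≃g F) (h : F.IsColorCritical r) : G.IsColorCritical r := by
  obtain ⟨hcol, hmin, hvert, hedge⟩ := isColorCritical_iff.mp h
  refine isColorCritical_iff.mpr ⟨hcol.of_hom e.toHom, fun m hm ↦ hmin m (hm.of_hom e.symm.toHom),
    fun v ↦ ?_, fun a b hab ↦ ?_⟩
  · obtain ⟨m, hm, hc⟩ := hvert (e v)
    let f : G.induce {v}ᶜ →g F.induce {e v}ᶜ :=
      ⟨fun x ↦ ⟨e x, fun hx ↦ x.2 (e.injective hx)⟩, fun {x y} hxy ↦ e.map_adj_iff.mpr hxy⟩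
    exact ⟨m, hm, hc.of_hom f⟩
  · obtain ⟨m, hm, hc⟩ := hedge (e a) (e b) (e.map_adj_iff.mpr hab)
    refine ⟨m, hm, hc.of_hom ⟨e, fun {x y} hxy ↦ ?_⟩⟩
    simp only [deleteEdges_adj, Set.mem_singleton_iff, Sym2.eq_iff, e.injective.eq_iff,
      e.map_adj_iff] at hxy ⊢
    exact hxy

lemma nonempty_iso_of_isColorCritical (h : G.IsColorCritical (k + 1)) (hFG : F ⊑ G)
    (hF : ¬ F.Colorable k) : Nonempty (G ≃g F) := by
  obtain ⟨f⟩ := hFG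
  by_cases htop : f.toSubgraph = ⊤
  · have e := f.isoToSubgraph
    rw [htop] at e
    exact ⟨(e.trans Subgraph.topIso).symm⟩
  · obtain ⟨m, hm, hc⟩ := chromaticNumber_lt_iff_exists_colorable.mp (h.2 _ htop)
    exact absurd ((hc.mono (Nat.le_of_lt_succ hm)).of_hom f.isoToSubgraph.toHom) hF

end Critical

section Join

variable {V W : Type*} {G : SimpleGraph V} {F : SimpleGraph W} {a b k n r s : ℕ}

@[simp] lemma joinGraph_adj_inl_inl {x y : V} :
    (G.joinGraph F).Adj (.inl x) (.inl y) ↔ G.Adj x y := by simp [joinGraph]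

@[simp] lemma joinGraph_adj_inr_inr {x y : W} :
    (G.joinGraph F).Adj (.inr x) (.inr y) ↔ F.Adj x y := by simp [joinGraph]

@[simp] lemma joinGraph_adj_inl_inr {x : V} {y : W} :
    (G.joinGraph F).Adj (.inl x) (.inr y) := by simp [joinGraph]

@[simp] lemma joinGraph_adj_inr_inl {x : V} {y : W} :
    (G.joinGraph F).Adj (.inr y) (.inl x) := by simp [joinGraph]

lemma colorable_joinGraph (hG : G.Colorable a) (hF : F.Colorable b) :
    (G.joinGraph F).Colorable (a + b) := by
  obtain ⟨c⟩ := hG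
  obtain ⟨d⟩ := hF
  let e : (G.joinGraph F).Coloring (Fin a ⊕ Fin b) := Coloring.mk (Sum.map c d) <| by
    rintro (x | x) (y | y) hxy
    · simpa using c.valid (joinGraph_adj_inl_inl.mp hxy)
    · simp
    · simp
    · simpa using d.valid (joinGraph_adj_inr_inr.mp hxy)
  simpa only [Fintype.card_sum, Fintype.card_fin] using e.colorable

lemma exists_colorable_of_colorable_joinGraph (h : (G.joinGraph F).Colorable n) :
    ∃ a b, a + b ≤ n ∧ G.Colorable a ∧ F.Colorable b := by
  classical
  obtain ⟨c⟩ := h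
  let A : Finset (Fin n) := {i | ∃ x, c (.inl x) = i}
  refine ⟨A.card, Aᶜ.card, (A.card_add_card_compl.trans (Fintype.card_fin n)).le, ?_, ?_⟩
  · let d : G.Coloring A := Coloring.mk (fun x ↦ ⟨c (.inl x), by simp [A]⟩) fun hxy h ↦
      c.valid (joinGraph_adj_inl_inl.mpr hxy) (Subtype.ext_iff.mp h)
    simpa using d.colorable
  · let d : F.Coloring ↥Aᶜ := Coloring.mk (fun y ↦ ⟨c (.inr y), by
      simpa [A] using fun x ↦ c.valid (joinGraph_adj_inl_inr (x := x))⟩) fun hxy h ↦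
      c.valid (joinGraph_adj_inr_inr.mpr hxy) (Subtype.ext_iff.mp h)
    simpa only [Fintype.card_coe] using d.colorable

lemma not_colorable_addSimplicial (hG : ¬ G.Colorable n) :
    ¬ (G.addSimplicial k).Colorable (n + k) := by
  intro h
  obtain ⟨a, b, hab, ha, hb⟩ := exists_colorable_of_colorable_joinGraph h
  have hkb : k ≤ b := by simpa using hb.card_le_of_pairwise_adj id fun _ _ h ↦ h
  exact hG (ha.mono (by lia))

lemma addSimplicial_isContained {s t : Set V} [Finite t] (hF : F ⊑ G.induce s)
    (ht : G.IsClique t) (hst : ∀ v ∈ t, ∀ w ∈ s, G.Adj v w) : F.addSimplicial t.ncard ⊑ G := by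
  obtain ⟨f⟩ := hF
  let e : Fin t.ncard ≃ t := (Finite.equivFinOfCardEq (Nat.card_coe_set_eq t)).symm
  refine ⟨⟨⟨Sum.elim (fun x ↦ f x) fun i ↦ e i, ?_⟩, ?_⟩⟩
  · rintro (x | i) (y | j) hxy
    · exact f.toHom.map_rel (joinGraph_adj_inl_inl.mp hxy)
    · exact (hst _ (e j).2 _ (f x).2).symm
    · exact hst _ (e i).2 _ (f y).2
    · refine ht (e i).2 (e j).2 (Subtype.val_injective.ne (e.injective.ne ?_))
      exact joinGraph_adj_inr_inr.mp hxy
  · exact (Subtype.val_injective.comp f.injective).sumElim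
      (Subtype.val_injective.comp e.injective) fun x i ↦ (hst _ (e i).2 _ (f x).2).ne'

lemma colorable_induce_joinGraph {S : Set (V ⊕ W)} {A : Set V} {B : Set W}
    (hA : Sum.inl ⁻¹' S ⊆ A) (hB : Sum.inr ⁻¹' S ⊆ B) (hG : (G.induce A).Colorable a)
    (hF : (F.induce B).Colorable b) : ((G.joinGraph F).induce S).Colorable (a + b) := by
  let f : (G.joinGraph F).induce S →g (G.induce A).joinGraph (F.induce B) :=
    { toFun
        | ⟨.inl x, hx⟩ => .inl ⟨x, hA hx⟩
        | ⟨.inr y, hy⟩ => .inr ⟨y, hB hy⟩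
      map_rel' := by
        rintro ⟨x | x, hx⟩ ⟨y | y, hy⟩ hxy
        · have h : G.Adj x y := by simpa using hxy
          simpa using h
        · exact joinGraph_adj_inl_inr
        · exact joinGraph_adj_inr_inl
        · have h : F.Adj x y := by simpa using hxy
          simpa using h }
  exact (colorable_joinGraph hG hF).of_hom f

lemma exists_colorable_induce_compl_joinGraph (hG : G.IsColorCritical r)
    (hF : F.IsColorCritical s) (v : V ⊕ W) :
    ∃ m < r + s, ((G.joinGraph F).induce {v}ᶜ).Colorable m := by
  obtain ⟨hGr, -, hGvert, -⟩ := isColorCritical_iff.mp hG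
  obtain ⟨hFs, -, hFvert, -⟩ := isColorCritical_iff.mp hF
  rcases v with x | y
  · obtain ⟨m, hm, hc⟩ := hGvert x
    exact ⟨m + s, by lia, colorable_induce_joinGraph (fun z hz h ↦ hz (congrArg Sum.inl h))
      (Set.subset_univ _) hc (hFs.of_hom (Embedding.induce _).toHom)⟩
  · obtain ⟨n, hn, hc⟩ := hFvert y
    exact ⟨r + n, by lia, colorable_induce_joinGraph (Set.subset_univ _)
      (fun z hz h ↦ hz (congrArg Sum.inr h)) (hGr.of_hom (Embedding.induce _).toHom) hc⟩

lemma exists_colorable_deleteEdges_inl_inr (hG : G.IsColorCritical r)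
    (hF : F.IsColorCritical s) (x : V) (y : W) :
    ∃ m < r + s, ((G.joinGraph F).deleteEdges {s(.inl x, .inr y)}).Colorable m := by
  obtain ⟨m, hm, hGx⟩ := (isColorCritical_iff.mp hG).2.2.1 x
  obtain ⟨n, hn, hFy⟩ := (isColorCritical_iff.mp hF).2.2.1 y
  refine ⟨m + n + 1, by lia, colorable_succ_of_isIndepSet (S := {.inl x, .inr y}) ?_ ?_⟩
  · simp [← isClique_compl]
  · refine (colorable_induce_joinGraph ?_ ?_ hGx hFy).mono_left
      (comap_monotone _ (deleteEdges_le _))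
    · exact fun z hz h ↦ hz (.inl (congrArg Sum.inl h))
    · exact fun z hz h ↦ hz (.inr (congrArg Sum.inr h))

lemma exists_colorable_deleteEdges_joinGraph (hG : G.IsColorCritical r)
    (hF : F.IsColorCritical s) {v w : V ⊕ W} (hvw : (G.joinGraph F).Adj v w) :
    ∃ m < r + s, ((G.joinGraph F).deleteEdges {s(v, w)}).Colorable m := by
  obtain ⟨hGr, -, -, hGedge⟩ := isColorCritical_iff.mp hG
  obtain ⟨hFs, -, -, hFedge⟩ := isColorCritical_iff.mp hF
  rcases v with x | x <;> rcases w with y | y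
  · obtain ⟨m, hm, hc⟩ := hGedge x y (joinGraph_adj_inl_inl.mp hvw)
    refine ⟨m + s, by lia, (colorable_joinGraph hc hFs).mono_left ?_⟩
    rintro (z | z) (t | t) hzt <;> simp_all
  · exact exists_colorable_deleteEdges_inl_inr hG hF x y
  · exact Sym2.eq_swap ▸ exists_colorable_deleteEdges_inl_inr hG hF y x
  · obtain ⟨n, hn, hc⟩ := hFedge x y (joinGraph_adj_inr_inr.mp hvw)
    refine ⟨r + n, by lia, (colorable_joinGraph hGr hc).mono_left ?_⟩
    rintro (z | z) (t | t) hzt <;> simp_all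

theorem isColorCritical_joinGraph (hG : G.IsColorCritical r) (hF : F.IsColorCritical s) :
    (G.joinGraph F).IsColorCritical (r + s) := by
  refine isColorCritical_iff.mpr ⟨colorable_joinGraph (colorable_of_isColorCritical hG)
    (colorable_of_isColorCritical hF), fun n hn ↦ ?_,
    exists_colorable_induce_compl_joinGraph hG hF,
    fun _ _ ↦ exists_colorable_deleteEdges_joinGraph hG hF⟩
  obtain ⟨a, b, hab, ha, hb⟩ := exists_colorable_of_colorable_joinGraph hn
  exact (Nat.add_le_add (le_of_isColorCritical_of_colorable hG ha)
    (le_of_isColorCritical_of_colorable hF hb)).trans hab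

lemma isColorCritical_completeGraph (k : ℕ) : (completeGraph (Fin k)).IsColorCritical k := by
  have hcard (v : Fin k) : Fintype.card ↥({v}ᶜ : Set (Fin k)) = k - 1 := by
    rw [Fintype.card_compl_set, Fintype.card_fin, Set.card_singleton]
  refine isColorCritical_iff.mpr ⟨⟨Coloring.mk id fun h ↦ h⟩, fun m hm ↦ ?_, fun v ↦ ?_,
    fun v w hvw ↦ ?_⟩
  · simpa using hm.card_le_of_pairwise_adj id fun _ _ h ↦ h
  · exact ⟨k - 1, by have := v.pos; lia, hcard v ▸ colorable_of_fintype _⟩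
  · let c : ((completeGraph (Fin k)).deleteEdges {s(v, w)}).Coloring ↥({w}ᶜ : Set (Fin k)) :=
      Coloring.mk (fun x ↦ if h : x = w then ⟨v, hvw⟩ else ⟨x, h⟩) fun {x y} hxy ↦ by
        simp only [deleteEdges_adj, top_adj, Set.mem_singleton_iff, Sym2.eq_iff] at hxy
        grind
    exact ⟨k - 1, by have := v.pos; lia, hcard w ▸ c.colorable⟩

lemma isColorCritical_addSimplicial (hG : G.IsColorCritical r) (k : ℕ) :
    (G.addSimplicial k).IsColorCritical (r + k) :=
  isColorCritical_joinGraph hG (isColorCritical_completeGraph k)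

lemma nonempty_addSimplicial_zero_iso (G : SimpleGraph V) : Nonempty (G.addSimplicial 0 ≃g G) := by
  refine ⟨⟨Equiv.sumEmpty V (Fin 0), ?_⟩⟩
  rintro (a | a) (b | b)
  · exact joinGraph_adj_inl_inl.symm
  all_goals exact Fin.elim0 ‹Fin 0›

end Join

section Matching

variable {V W : Type*} {G H : SimpleGraph V} {F : SimpleGraph W} {k : ℕ}

lemma two_mul_ncard_edgeSet_of_isPerfectMatching [Finite V] {M : G.Subgraph}
    (hM : M.IsPerfectMatching) : 2 * M.edgeSet.ncard = Nat.card V := by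
  classical
  have := Fintype.ofFinite V
  have hdeg (v : V) : M.spanningCoe.degree v = 1 := by
    simpa using Subgraph.isPerfectMatching_iff_forall_degree.mp hM v
  have hsum := M.spanningCoe.sum_degrees_eq_twice_card_edges
  simp only [hdeg, Finset.sum_const, Finset.card_univ, smul_eq_mul, mul_one] at hsum
  rw [Nat.card_eq_fintype_card, hsum, ← Subgraph.edgeSet_spanningCoe, ← coe_edgeFinset,
    Set.ncard_coe_finset]

lemma colorable_of_isPerfectMatching_compl_joinGraph [Finite V] [Finite W]
    {M : (Gᶜ.joinGraph F).Subgraph} (hM : M.IsPerfectMatching)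
    (hk : Nat.card V + Nat.card W ≤ 2 * k) : G.Colorable k := by
  have : Fintype M.edgeSet := Fintype.ofFinite _
  let c : G.Coloring M.edgeSet := Coloring.mk (fun v ↦ hM.1.toEdge ⟨.inl v, hM.2 _⟩) <| by
    intro v w hvw hc
    have hv := hM.1.mem_coe_toEdge (hM.2 (.inl v))
    have hw := hc ▸ hM.1.mem_coe_toEdge (hM.2 (.inl w))
    have hedge := (Sym2.mem_and_mem_iff (Sum.inl_injective.ne hvw.ne)).mp ⟨hv, hw⟩
    have hadj : (Gᶜ.joinGraph F).Adj (.inl v) (.inl w) :=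
      Subgraph.edgeSet_subset M (hedge ▸ Subtype.coe_prop _)
    exact (joinGraph_adj_inl_inl.mp hadj).2 hvw
  have hcard := two_mul_ncard_edgeSet_of_isPerfectMatching hM
  rw [Nat.card_sum] at hcard
  refine c.colorable.mono ?_
  rw [← Nat.card_eq_fintype_card, Nat.card_coe_set_eq]
  lia

lemma ncard_oddComponents_eq_of_iso (e : G ≃g F) :
    G.oddComponents.ncard = F.oddComponents.ncard := by
  have hsupp (C : G.ConnectedComponent) :
      C.supp.ncard = (e.connectedComponentEquiv C).supp.ncard :=
    Nat.card_congr (C.isoEquivSupp e)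
  refine Set.ncard_congr (fun C _ ↦ e.connectedComponentEquiv C) (fun C hC ↦ ?_)
    (fun C D _ _ h ↦ e.connectedComponentEquiv.injective h) fun D hD ↦
      ⟨e.connectedComponentEquiv.symm D, ?_, e.connectedComponentEquiv.apply_symm_apply D⟩
  · simpa only [Set.mem_ofPred_eq, hsupp] using hC
  · simpa only [Set.mem_ofPred_eq, hsupp, Equiv.apply_symm_apply] using hD

lemma ncard_oddComponents_le_one_of_connected (hG : G.Connected) : G.oddComponents.ncard ≤ 1 := by
  have := hG.preconnected.subsingleton_connectedComponent
  exact Set.ncard_le_one_of_subsingleton _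

lemma nonempty_iso_coe_deleteVerts_joinGraph {u : Set (V ⊕ W)} (hu : Set.range Sum.inr ⊆ u) :
    Nonempty (((⊤ : (H.joinGraph F).Subgraph).deleteVerts u).coe ≃g
      H.induce (Sum.inl ⁻¹' u)ᶜ) := by
  let f : H.induce (Sum.inl ⁻¹' u)ᶜ ↪g ((⊤ : (H.joinGraph F).Subgraph).deleteVerts u).coe :=
    { toFun x := ⟨.inl x, trivial, x.2⟩
      inj' x y hxy := Subtype.ext (Sum.inl_injective (Subtype.ext_iff.mp hxy))
      map_rel_iff' {x y} := (Subgraph.deleteVerts_adj).trans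
        ⟨fun h ↦ (joinGraph_adj_inl_inl (G := H) (F := F)).mp h.2.2.2.2,
          fun h ↦ ⟨trivial, x.2, trivial, y.2, joinGraph_adj_inl_inl.mpr h⟩⟩ }
  refine ⟨(RelIso.ofSurjective f ?_).symm⟩
  rintro ⟨x | y, -, hx⟩
  · exact ⟨⟨x, hx⟩, rfl⟩
  · exact absurd (hu ⟨y, rfl⟩) hx

lemma connected_coe_deleteVerts_addSimplicial {d : ℕ} {u : Set (V ⊕ Fin d)} {j : Fin d}
    (hj : .inr j ∉ u) : ((⊤ : (H.addSimplicial d).Subgraph).deleteVerts u).coe.Connected := by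
  refine Connected.of_isUniversal (v := ⟨.inr j, trivial, hj⟩) ?_
  rintro ⟨x | i, _, hx⟩ hne
  · exact Subgraph.deleteVerts_adj.mpr ⟨trivial, hj, trivial, hx, joinGraph_adj_inr_inl⟩
  · refine Subgraph.deleteVerts_adj.mpr ⟨trivial, hj, trivial, hx, joinGraph_adj_inr_inr.mpr ?_⟩
    exact fun hji ↦ hne (Subtype.ext (congrArg Sum.inr hji))

lemma ncard_add_two_le_of_isTutteViolator [Finite V] (hV : Even (Nat.card V)) {u : Set V}
    (hu : G.IsTutteViolator u) :
    u.ncard + 2 ≤ ((⊤ : G.Subgraph).deleteVerts u).coe.oddComponents.ncard := by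
  have hodd := odd_ncard_oddComponents (G := ((⊤ : G.Subgraph).deleteVerts u).coe)
  have hcard : Nat.card ((⊤ : G.Subgraph).deleteVerts u).verts + u.ncard = Nat.card V := by
    rw [Nat.card_coe_set_eq, Subgraph.deleteVerts_verts, Subgraph.verts_top,
      ← Set.compl_eq_univ_sdiff, add_comm, Set.ncard_add_ncard_compl]
  rw [IsTutteViolator] at hu
  grind

-- Pad `Gᶜ` with `2k - |V|` universal vertices: a perfect matching of the result would give a
-- `k`-colouring of `G`, so there is a Tutte violator, and it contains all the padding.
theorem exists_ncard_add_le_ncard_oddComponents [Finite V] (hG : ¬ G.Colorable k)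
    (hk : Nat.card V ≤ 2 * k) :
    ∃ S : Set V, S.ncard + (2 * k - Nat.card V) + 2 ≤ (Gᶜ.induce Sᶜ).oddComponents.ncard := by
  set d := 2 * k - Nat.card V
  have hcard : Nat.card (V ⊕ Fin d) = 2 * k := by
    rw [Nat.card_sum, Nat.card_fin]
    lia
  have hno : ¬ ∃ M : (Gᶜ.addSimplicial d).Subgraph, M.IsPerfectMatching := fun ⟨M, hM⟩ ↦
    hG (colorable_of_isPerfectMatching_compl_joinGraph hM (by rw [← Nat.card_sum, hcard]))
  obtain ⟨u, hu⟩ : ∃ u, (Gᶜ.addSimplicial d).IsTutteViolator u := by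
    simpa only [tutte, not_forall, not_not] using hno
  have htwo := ncard_add_two_le_of_isTutteViolator (hcard ▸ even_two_mul k) hu
  have hrange : Set.range Sum.inr ⊆ u := by
    rintro _ ⟨j, rfl⟩
    by_contra hj
    have hone := ncard_oddComponents_le_one_of_connected
      (connected_coe_deleteVerts_addSimplicial (H := Gᶜ) hj)
    lia
  obtain ⟨e⟩ := nonempty_iso_coe_deleteVerts_joinGraph (H := Gᶜ) hrange
  have hucard : (Sum.inl ⁻¹' u).ncard + d = u.ncard := by
    have hinr : (Sum.inr ⁻¹' u : Set (Fin d)).ncard = d := by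
      rw [Set.preimage_eq_univ_iff.mpr hrange, Set.ncard_univ, Nat.card_fin]
    calc (Sum.inl ⁻¹' u).ncard + d
        = (Sum.inl '' (Sum.inl ⁻¹' u) : Set (V ⊕ Fin d)).ncard +
            (Sum.inr '' (Sum.inr ⁻¹' u) : Set (V ⊕ Fin d)).ncard := by
          rw [Set.ncard_image_of_injective _ Sum.inl_injective,
            Set.ncard_image_of_injective _ Sum.inr_injective, hinr]
      _ = u.ncard := by
          rw [← Set.ncard_union_eq Set.disjoint_image_inl_image_inr,
            Set.image_preimage_inl_union_image_preimage_inr]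
  refine ⟨Sum.inl ⁻¹' u, ?_⟩
  rw [← ncard_oddComponents_eq_of_iso e, hucard]
  exact htwo

end Matching

section Counting

open scoped Finset

variable {V : Type*} {H : SimpleGraph V}

open Classical in
lemma mul_ncard_oddComponents_le_sum [Fintype V] (f : V → ℕ) {a : ℕ}
    (hf : ∀ C ∈ H.oddComponents, a ≤ ∑ v with H.connectedComponentMk v = C, f v) :
    a * H.oddComponents.ncard ≤ ∑ v, f v := by
  calc a * H.oddComponents.ncard = ∑ _C with _C ∈ H.oddComponents, a := by
        rw [Finset.sum_const, smul_eq_mul, mul_comm, ← Set.ncard_coe_finset]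
        simp
    _ ≤ ∑ C with C ∈ H.oddComponents, ∑ v with H.connectedComponentMk v = C, f v :=
        Finset.sum_le_sum fun C hC ↦ hf C (Finset.mem_filter.mp hC).2
    _ ≤ ∑ C, ∑ v with H.connectedComponentMk v = C, f v :=
        Finset.sum_le_sum_of_subset (Finset.filter_subset _ _)
    _ = ∑ v, f v := Finset.sum_fiberwise _ _ _

/-- The weight of a vertex `v` in the count of the odd components of `H - S`. The constants are
such that every odd component has weight at least 5, while the edges to `S` contribute at most
`6 * #S` if all degrees are at most 3. -/
def weight (H : SimpleGraph V) [DecidableRel H.Adj] [DecidablePred (· ∈ H.support)]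
    (S : Finset V) (v : V) : ℕ :=
  2 * #{x ∈ S | H.Adj v x} + (if v ∈ H.support then 0 else 4) + 1

-- Here and below `hdom` says that in `Hᶜ` no neighbourhood of a vertex lies in that of a
-- non-neighbour.
lemma five_le_weight_of_singleton [DecidableRel H.Adj] [DecidablePred (· ∈ H.support)]
    (hdom : ∀ u v, H.Adj u v → ∃ x ≠ u, H.Adj v x ∧ ¬ H.Adj u x) {S : Finset V} {v : V}
    (hclosed : ∀ x, H.Adj v x → x ∈ S) : 5 ≤ weight H S v := by
  rw [weight]
  split_ifs with hv
  · obtain ⟨u, huv⟩ := H.mem_support.mp hv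
    obtain ⟨x, hxu, hvx, -⟩ := hdom u v huv.symm
    have htwo : 1 < #{x ∈ S | H.Adj v x} := Finset.one_lt_card.mpr
      ⟨x, Finset.mem_filter.mpr ⟨hclosed x hvx, hvx⟩,
        u, Finset.mem_filter.mpr ⟨hclosed u huv, huv⟩, hxu⟩
    lia
  · lia

lemma four_le_card_of_closed
    (hdom : ∀ u v, H.Adj u v → ∃ x ≠ u, H.Adj v x ∧ ¬ H.Adj u x) {C : Finset V}
    (hC : C.Nonempty) (hsupp : ∀ v ∈ C, v ∈ H.support)
    (hclosed : ∀ v ∈ C, ∀ x, H.Adj v x → x ∈ C) : 4 ≤ #C := by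
  classical
  obtain ⟨v, hv⟩ := hC
  obtain ⟨u, hvu⟩ := H.mem_support.mp (hsupp v hv)
  have hu := hclosed v hv u hvu
  obtain ⟨x, hxu, hvx, -⟩ := hdom u v hvu.symm
  obtain ⟨y, hyv, huy, hvy⟩ := hdom v u hvu
  have hsub : {v, u, x, y} ⊆ C := by
    simp only [Finset.insert_subset_iff, Finset.singleton_subset_iff]
    exact ⟨hv, hu, hclosed v hv x hvx, hclosed u hu y huy⟩
  have hxy : x ≠ y := by
    rintro rfl
    exact hvy hvx
  have hcard : ({v, u, x, y} : Finset V).card = 4 := by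
    have := hvu.ne
    have := hvx.ne
    have := huy.ne
    grind
  exact hcard ▸ Finset.card_le_card hsub

lemma five_le_sum_weight_of_odd_card [DecidableRel H.Adj] [DecidablePred (· ∈ H.support)]
    (hdom : ∀ u v, H.Adj u v → ∃ x ≠ u, H.Adj v x ∧ ¬ H.Adj u x) {S C : Finset V}
    (hC : Odd #C) (hclosed : ∀ v ∈ C, ∀ x, H.Adj v x → x ∈ C ∨ x ∈ S) :
    5 ≤ ∑ v ∈ C, weight H S v := by
  classical
  have hone_le (D : Finset V) : #D ≤ ∑ v ∈ D, weight H S v := by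
    simpa using D.card_nsmul_le_sum (weight H S) 1 fun v _ ↦ Nat.le_add_left 1 _
  by_contra! hlt
  have hcard : #C = 1 ∨ #C = 3 := by
    have := hone_le C
    grind
  rcases hcard with hone | hthree
  · obtain ⟨v, rfl⟩ := Finset.card_eq_one.mp hone
    rw [Finset.sum_singleton] at hlt
    refine absurd (five_le_weight_of_singleton hdom fun x hvx ↦ ?_) hlt.not_ge
    exact (hclosed v (Finset.mem_singleton_self v) x hvx).resolve_left fun hx ↦
      hvx.ne (Finset.mem_singleton.mp hx).symm
  · have hweight {v : V} (hv : v ∈ C) : weight H S v ≤ 2 := by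
      have hrest := hone_le (C.erase v)
      have := Finset.add_sum_erase C (weight H S) hv
      rw [Finset.card_erase_of_mem hv] at hrest
      lia
    have hsupp {v : V} (hv : v ∈ C) : v ∈ H.support := by
      have := hweight hv
      rw [weight] at this
      grind
    have hnone {v : V} (hv : v ∈ C) {x : V} (hx : x ∈ S) : ¬ H.Adj v x := by
      have hempty : {x ∈ S | H.Adj v x} = ∅ := by
        have := hweight hv
        rw [weight] at this
        rw [← Finset.card_eq_zero]
        lia
      exact Finset.filter_eq_empty_iff.mp hempty hx
    have := four_le_card_of_closed hdom (Finset.card_pos.mp (by lia)) (fun v hv ↦ hsupp hv)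
      fun v hv x hvx ↦ (hclosed v hv x hvx).resolve_right fun hx ↦ hnone hv hx hvx
    lia

lemma sum_weight_compl_le [Fintype V] [DecidableEq V] [DecidableRel H.Adj] {d : ℕ}
    (hdeg : ∀ v, H.degree v ≤ d) (S : Finset V) :
    ∑ v ∈ Sᶜ, weight H S v ≤ 2 * (d * #S) + 4 * H.supportᶜ.ncard + #Sᶜ := by
  classical
  have hcross : ∑ v ∈ Sᶜ, #{x ∈ S | H.Adj v x} ≤ d * #S := by
    calc ∑ v ∈ Sᶜ, #{x ∈ S | H.Adj v x}
        ≤ ∑ v, #{x ∈ S | H.Adj v x} := Finset.sum_le_sum_of_subset (Finset.subset_univ _)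
      _ = ∑ x ∈ S, #{v | H.Adj v x} :=
          Finset.sum_card_bipartiteAbove_eq_sum_card_bipartiteBelow H.Adj
      _ ≤ ∑ _x ∈ S, d := Finset.sum_le_sum fun x _ ↦ by
          simpa only [← card_neighborFinset_eq_degree, neighborFinset_eq_filter, H.adj_comm]
            using hdeg x
      _ = d * #S := by rw [Finset.sum_const, smul_eq_mul, mul_comm]
  have hisolated : ∑ v ∈ Sᶜ, (if v ∈ H.support then 0 else 4) ≤ 4 * H.supportᶜ.ncard := by
    calc ∑ v ∈ Sᶜ, (if v ∈ H.support then 0 else 4)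
        ≤ ∑ v : V, (if v ∈ H.support then 0 else 4) :=
          Finset.sum_le_sum_of_subset (Finset.subset_univ _)
      _ = 4 * #{v | v ∉ H.support} := by
          rw [Finset.sum_ite, Finset.sum_const_zero, zero_add, Finset.sum_const, smul_eq_mul,
            mul_comm]
      _ = 4 * H.supportᶜ.ncard := by
          rw [Set.ncard_eq_toFinset_card', Set.toFinset_compl]
          congr 2
          ext
          simp
  simp only [weight, Finset.sum_add_distrib, ← Finset.mul_sum, Finset.sum_const, smul_eq_mul,
    mul_one]
  lia

lemma five_le_sum_weight_of_mem_oddComponents [Fintype V] [DecidableRel H.Adj]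
    [DecidablePred (· ∈ H.support)] (hdom : ∀ u v, H.Adj u v → ∃ x ≠ u, H.Adj v x ∧ ¬ H.Adj u x)
    {S : Finset V} [DecidablePred (· ∈ (S : Set V)ᶜ)]
    {C : (H.induce (S : Set V)ᶜ).ConnectedComponent}
    [DecidablePred fun v ↦ (H.induce (S : Set V)ᶜ).connectedComponentMk v = C]
    (hC : C ∈ (H.induce (S : Set V)ᶜ).oddComponents) :
    5 ≤ ∑ v with (H.induce (S : Set V)ᶜ).connectedComponentMk v = C, weight H S v := by
  set D : Finset ↥((S : Set V)ᶜ) := {v | (H.induce (S : Set V)ᶜ).connectedComponentMk v = C}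
  have hD : (D : Set ↥((S : Set V)ᶜ)) = C.supp := Finset.coe_filter_univ _
  have hodd : Odd (D.map (Function.Embedding.subtype _)).card := by
    rwa [Finset.card_map, ← Set.ncard_coe_finset, hD]
  refine (five_le_sum_weight_of_odd_card (S := S) hdom hodd fun v hv x hvx ↦ ?_).trans_eq
    (Finset.sum_map _ _ _)
  obtain ⟨v, hvD, rfl⟩ := Finset.mem_map.mp hv
  by_cases hx : x ∈ S
  · exact .inr hx
  · refine .inl (Finset.mem_map.mpr ⟨⟨x, hx⟩, ?_, rfl⟩)
    rw [Finset.mem_filter_univ] at hvD ⊢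
    rw [← hvD, ConnectedComponent.eq]
    exact (induce_adj.mpr hvx.symm : (H.induce (S : Set V)ᶜ).Adj ⟨x, hx⟩ v).reachable

theorem ncard_support_le_of_le_ncard_oddComponents [Fintype V] [DecidableRel H.Adj]
    (hdeg : ∀ v, H.degree v ≤ 3) (hdom : ∀ u v, H.Adj u v → ∃ x ≠ u, H.Adj v x ∧ ¬ H.Adj u x)
    {S : Set V} (hS : S.ncard + Nat.card V ≤ (H.induce Sᶜ).oddComponents.ncard + 6) :
    H.support.ncard ≤ 7 := by
  classical
  lift S to Finset V using S.toFinite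
  have hodd := mul_ncard_oddComponents_le_sum (fun v : ↥(S : Set V)ᶜ ↦ weight H S v)
    fun C hC ↦ five_le_sum_weight_of_mem_oddComponents hdom hC
  have hsum := sum_weight_compl_le hdeg S
  have hsub : ∑ v ∈ Sᶜ, weight H S v = ∑ v : ↥(S : Set V)ᶜ, weight H S v :=
    Finset.sum_subtype _ (by simp) _
  have hSc := S.card_add_card_compl
  have hsupp := H.support.ncard_add_ncard_compl
  rw [Set.ncard_coe_finset] at hS
  rw [Nat.card_eq_fintype_card] at hS hsupp
  lia

theorem ncard_support_compl_le {G : SimpleGraph V} {k : ℕ} [Finite V] (hG : ¬ G.Colorable k)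
    (hcrit : ∀ v, (G.induce {v}ᶜ).Colorable k) (hV : Nat.card V = k + 4) :
    Gᶜ.support.ncard ≤ 7 := by
  classical
  have := Fintype.ofFinite V
  rcases le_or_gt k 3 with hk | hk
  · exact Gᶜ.support.ncard_le_card.trans (by lia)
  obtain ⟨S, hS⟩ := exists_ncard_add_le_ncard_oddComponents hG (by lia)
  refine ncard_support_le_of_le_ncard_oddComponents (fun v ↦ ?_) (fun u v huv ↦ ?_)
    (S := S) (by lia)
  · have hdeg := le_degree_of_colorable_induce_compl hG (hcrit v)
    rw [degree_compl, ← Nat.card_eq_fintype_card, hV]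
    lia
  · obtain ⟨x, hux, hvx⟩ := Set.not_subset.mp
      (not_neighborSet_subset_of_colorable_induce_compl hG huv.ne (hcrit u))
    refine ⟨x, hux.ne', ⟨?_, hvx⟩, fun h ↦ h.2 hux⟩
    rintro rfl
    exact huv.2 hux

end Counting

section OddCycle

variable {V : Type*} {G : SimpleGraph V}

lemma exists_isCycle_odd_length_of_odd_length_add_length_bypass [DecidableEq V] {u v : V}
    (p : G.Walk u v) (hp : Odd (p.length + p.bypass.length)) :
    ∃ (w : V) (c : G.Walk w w), c.IsCycle ∧ Odd c.length := by
  induction p with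
  | nil => simp [Walk.bypass] at hp
  | @cons u x v h q ih =>
    by_cases hq : Odd (q.length + q.bypass.length)
    · exact ih hq
    by_cases hu : u ∈ q.bypass.support
    · have hlen := congrArg Walk.length (q.bypass.take_spec hu)
      have hne : (q.bypass.takeUntil u hu).length ≠ 0 :=
        fun hzero ↦ h.ne (Walk.eq_of_length_eq_zero hzero).symm
      rw [Walk.length_append] at hlen
      simp only [Walk.bypass, hu, dite_true, Walk.length_cons] at hp
      refine ⟨u, .cons h (q.bypass.takeUntil u hu), ?_, ?_⟩
      · rw [Walk.isCycle_iff_isPath_tail_and_le_length]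
        refine ⟨by simpa using q.bypass_isPath.takeUntil hu, ?_⟩
        rw [Walk.length_cons]
        grind
      · rw [Walk.length_cons]
        grind
    · simp only [Walk.bypass, hu, dite_false, Walk.length_cons] at hp
      grind

theorem exists_odd_cycleGraph_isContained (hG : ¬ G.Colorable 2) :
    ∃ n, Odd n ∧ 3 ≤ n ∧ cycleGraph n ⊑ G := by
  classical
  simp only [two_colorable_iff_forall_loop_even, not_forall, Nat.not_even_iff_odd] at hG
  obtain ⟨u, p, hp⟩ := hG
  have hbypass : p.bypass.length = 0 :=
    Walk.length_eq_zero_iff.mpr (Walk.isPath_iff_nil.mp p.bypass_isPath)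
  obtain ⟨w, c, hc, hodd⟩ := exists_isCycle_odd_length_of_odd_length_add_length_bypass p
    (by rwa [hbypass])
  exact ⟨c.length, hodd, hc.three_le_length,
    (cycleGraph_isContained_iff hc.three_le_length).mpr ⟨w, c, hc, rfl⟩⟩

lemma cycleGraph_isContained_of_adj {n : ℕ} {f : Fin (n + 2) → V} (hf : f.Injective)
    (hadj : ∀ i, G.Adj (f i) (f (i + 1))) : cycleGraph (n + 2) ⊑ G := by
  refine ⟨⟨⟨f, fun {i j} hij ↦ ?_⟩, hf⟩⟩
  rcases cycleGraph_adj.mp hij with h | h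
  · rw [eq_add_of_sub_eq' h]
    exact (hadj j).symm
  · rw [eq_add_of_sub_eq' h]
    exact hadj i

end OddCycle

section SevenVertices

variable {V : Type*} {G : SimpleGraph V}

lemma fromEdgeSet_isContained {W : Type*} {E : Set (Sym2 W)} {f : W → V} (hf : f.Injective)
    (hE : ∀ e ∈ E, e.map f ∈ G.edgeSet) : fromEdgeSet E ⊑ G :=
  ⟨⟨⟨f, fun {a b} hab ↦ by simpa using hE s(a, b) ((fromEdgeSet_adj E).mp hab).1⟩, hf⟩⟩

lemma not_cliqueFree_four_of_adj {a b c d : V} (hab : G.Adj a b) (hac : G.Adj a c)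
    (had : G.Adj a d) (hbc : G.Adj b c) (hbd : G.Adj b d) (hcd : G.Adj c d) :
    ¬ G.CliqueFree 4 := by
  classical
  refine fun hG ↦ hG {a, b, c, d} ((is3Clique_triple_iff.mpr ⟨hbc, hbd, hcd⟩).insert ?_)
  simp [hab, hac, had]

lemma not_adj_of_cliqueFree_three (hG : G.CliqueFree 3) {a b c : V} (hab : G.Adj a b)
    (hbc : G.Adj b c) : ¬ G.Adj a c := by
  classical
  exact fun hac ↦ hG {a, b, c} (is3Clique_triple_iff.mpr ⟨hab, hac, hbc⟩)

lemma injective_of_forall_adj {ι : Type*} {t : ι → V} (ht : ∀ i j, i ≠ j → G.Adj (t i) (t j)) :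
    t.Injective :=
  fun i j hij ↦ by_contra fun hne ↦ (ht i j hne).ne hij

section IndependentTriple

variable {I : Set V} {t : Fin 3 → V} {w : V}

lemma exists_triangle_of_isIndepSet [Finite V] (hG : ¬ G.Colorable 3) (hI : G.IsIndepSet I)
    (hcard : Iᶜ.ncard = 4) :
    ∃ (t : Fin 3 → V) (w : V), (∀ i j, i ≠ j → G.Adj (t i) (t j)) ∧ w ∉ Set.range t ∧
      Iᶜ = insert w (Set.range t) := by
  obtain ⟨n, hodd, hn, ⟨f⟩⟩ := exists_odd_cycleGraph_isContained
    (mt (colorable_succ_of_isIndepSet hI) hG)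
  have hle : n ≤ 4 := by
    simpa [hcard] using Nat.card_le_card_of_injective _ f.injective
  obtain rfl : n = 3 := by grind
  obtain ⟨t, htI⟩ : ∃ t : Fin 3 → V, ∀ i, t i = f i := ⟨fun i ↦ f i, fun _ ↦ rfl⟩
  have ht (i j : Fin 3) (hij : i ≠ j) : G.Adj (t i) (t j) := by
    rw [htI, htI]
    exact f.toHom.map_rel (by rwa [cycleGraph_three_eq_top])
  have hrange : Set.range t ⊆ Iᶜ := Set.range_subset_iff.mpr fun i ↦ htI i ▸ (f i).2
  have hcard_range : (Set.range t).ncard = 3 := by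
    rw [Set.ncard_range_of_injective (injective_of_forall_adj ht), Nat.card_fin]
  obtain ⟨w, hw⟩ : ∃ w, Iᶜ \ Set.range t = {w} := by
    rw [← Set.ncard_eq_one, Set.ncard_sdiff hrange, hcard, hcard_range]
  have hmem : w ∈ Iᶜ \ Set.range t := hw ▸ Set.mem_singleton w
  exact ⟨t, w, ht, hmem.2, by rw [← Set.singleton_union, ← hw, Set.sdiff_union_of_subset hrange]⟩

lemma exists_coloring_induce_compl (ht : ∀ i j, i ≠ j → G.Adj (t i) (t j)) (hw : w ∉ Set.range t)
    (hIc : Iᶜ = insert w (Set.range t)) {i : Fin 3} (hwi : ¬ G.Adj w (t i)) :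
    ∃ c : (G.induce Iᶜ).Coloring (Fin 3),
      ∀ b : ↥Iᶜ, (b : V) = w ∧ c b = i ∨ (b : V) = t (c b) := by
  set c : V → Fin 3 := Function.extend t id fun _ ↦ i
  have hct (j : Fin 3) : c (t j) = j := (injective_of_forall_adj ht).extend_apply _ _ _
  have hcw : c w = i := Function.extend_apply' _ _ _ hw
  have hvalid : ∀ a ∈ Iᶜ, ∀ b ∈ Iᶜ, G.Adj a b → c a ≠ c b := by
    rw [hIc]
    rintro a (rfl | ⟨j, rfl⟩) b (rfl | ⟨k, rfl⟩) hab
    · exact absurd rfl hab.ne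
    · rw [hcw, hct]
      rintro rfl
      exact hwi hab
    · rw [hcw, hct]
      rintro rfl
      exact hwi hab.symm
    · rw [hct, hct]
      rintro rfl
      exact hab.ne rfl
  refine ⟨Coloring.mk (fun b ↦ c b) fun {a b} hab ↦ hvalid a a.2 b b.2 hab, fun ⟨b, hb⟩ ↦ ?_⟩
  rcases hIc ▸ hb with rfl | ⟨j, rfl⟩
  · exact .inl ⟨rfl, hcw⟩
  · exact .inr (congrArg t (hct j)).symm

lemma exists_apex (hG : ¬ G.Colorable 3) (hK : G.CliqueFree 4) (hI : G.IsIndepSet I)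
    (ht : ∀ i j, i ≠ j → G.Adj (t i) (t j)) (hw : w ∉ Set.range t)
    (hIc : Iᶜ = insert w (Set.range t)) {i : Fin 3} (hwi : ¬ G.Adj w (t i)) :
    ∃ v ∈ I, G.Adj v w ∧ ∀ j, G.Adj v (t j) ↔ j ≠ i := by
  obtain ⟨c, hc⟩ := exists_coloring_induce_compl ht hw hIc hwi
  obtain ⟨v, hvI, hv⟩ : ∃ v ∈ I, ∀ a, ∃ b : ↥Iᶜ, G.Adj v b ∧ c b = a := by
    by_contra! h
    exact hG (nonempty_coloring_of_isIndepSet hI c h)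
  have htv (j : Fin 3) (hj : j ≠ i) : G.Adj v (t j) := by
    obtain ⟨b, hvb, rfl⟩ := hv j
    exact (hc b).resolve_left (fun h ↦ hj h.2) ▸ hvb
  have hvi : ¬ G.Adj v (t i) := fun hvi ↦ not_cliqueFree_four_of_adj hvi (htv (i + 1) (by grind))
    (htv (i + 2) (by grind)) (ht _ _ (by grind)) (ht _ _ (by grind)) (ht _ _ (by grind)) hK
  obtain ⟨b, hvb, rfl⟩ := hv i
  have hbw : b = w := ((hc b).resolve_right fun h ↦ hvi (h ▸ hvb)).1
  exact ⟨v, hvI, hbw ▸ hvb, fun j ↦ ⟨fun hj hji ↦ hvi (hji ▸ hj), htv j⟩⟩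

lemma not_adj_of_adj_of_cliqueFree_four (hG : ¬ G.Colorable 3) (hK : G.CliqueFree 4)
    (hI : G.IsIndepSet I) (ht : ∀ i j, i ≠ j → G.Adj (t i) (t j)) (hw : w ∉ Set.range t)
    (hIc : Iᶜ = insert w (Set.range t)) {i j : Fin 3} (hij : i ≠ j) (hwi : G.Adj w (t i)) :
    ¬ G.Adj w (t j) := by
  intro hwj
  have hthird : ∀ i j : Fin 3, ∃ k, k ≠ i ∧ k ≠ j := by decide
  obtain ⟨k, hki, hkj⟩ := hthird i j
  by_cases hwk : G.Adj w (t k)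
  · exact not_cliqueFree_four_of_adj hwi hwj hwk (ht i j hij) (ht i k hki.symm)
      (ht j k hkj.symm) hK
  · obtain ⟨v, -, hvw, hv⟩ := exists_apex hG hK hI ht hw hIc hwk
    exact not_cliqueFree_four_of_adj hvw ((hv i).mpr hki.symm) ((hv j).mpr hkj.symm) hwi hwj
      (ht i j hij) hK

lemma cycleGraph_five_addSimplicial_one_isContained_of_adj (hG : ¬ G.Colorable 3)
    (hK : G.CliqueFree 4) (hI : G.IsIndepSet I) (ht : ∀ i j, i ≠ j → G.Adj (t i) (t j))
    (hw : w ∉ Set.range t) (hIc : Iᶜ = insert w (Set.range t)) {i : Fin 3} (hwi : G.Adj w (t i)) :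
    (cycleGraph 5).addSimplicial 1 ⊑ G := by
  have hapex (j : Fin 3) (hij : i ≠ j) : ∃ v ∈ I, G.Adj v w ∧ ∀ k, G.Adj v (t k) ↔ k ≠ j :=
    exists_apex hG hK hI ht hw hIc
      (not_adj_of_adj_of_cliqueFree_four hG hK hI ht hw hIc hij hwi)
  have hothers : ∀ i : Fin 3, ∃ j k, i ≠ j ∧ i ≠ k ∧ j ≠ k := by decide
  obtain ⟨j, k, hij, hik, hjk⟩ := hothers i
  obtain ⟨x, hxI, hxw, hx⟩ := hapex j hij
  obtain ⟨y, hyI, hyw, hy⟩ := hapex k hik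
  have htI (l : Fin 3) : t l ∉ I := show t l ∈ Iᶜ by simp [hIc]
  have hxy : x ≠ y := fun h ↦ (hx j).mp (h ▸ (hy j).mpr hjk) rfl
  have hwt (l : Fin 3) : w ≠ t l := fun h ↦ hw ⟨l, h.symm⟩
  have hxj : x ≠ t j := ne_of_mem_of_not_mem hxI (htI j)
  have hxk : x ≠ t k := ne_of_mem_of_not_mem hxI (htI k)
  have hyj : y ≠ t j := ne_of_mem_of_not_mem hyI (htI j)
  have hyk : y ≠ t k := ne_of_mem_of_not_mem hyI (htI k)
  let f : Fin 5 → G.neighborSet (t i) := ![⟨w, hwi.symm⟩, ⟨x, ((hx i).mpr hij).symm⟩,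
    ⟨t k, ht i k hik⟩, ⟨t j, ht i j hij⟩, ⟨y, ((hy i).mpr hik).symm⟩]
  rw [← Set.ncard_singleton (t i)]
  refine addSimplicial_isContained (s := G.neighborSet (t i))
    (cycleGraph_isContained_of_adj (f := f) (List.nodup_ofFn.mp ?_) ?_) (by simp) (by simp)
  · simp [f, Subtype.ext_iff, hxy, hwt, hxj, hxk, hyj.symm, hyk.symm, hxw.ne', hyw.ne',
      (ht j k hjk).ne']
  · simp [f, Fin.forall_fin_succ, hxw.symm, hyw, hx, hy, hjk, hjk.symm, ht, G.adj_comm (t j) y]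

lemma cappedSun_isContained_of_forall_not_adj (hG : ¬ G.Colorable 3) (hK : G.CliqueFree 4)
    (hI : G.IsIndepSet I) (ht : ∀ i j, i ≠ j → G.Adj (t i) (t j)) (hw : w ∉ Set.range t)
    (hIc : Iᶜ = insert w (Set.range t)) (hwt : ∀ i, ¬ G.Adj w (t i)) : cappedSun ⊑ G := by
  choose v hvI hvw hv using fun i ↦ exists_apex hG hK hI ht hw hIc (hwt i)
  have htI (l : Fin 3) : t l ∉ I := show t l ∈ Iᶜ by simp [hIc]
  have hvt (i j : Fin 3) : t i ≠ v j := (ne_of_mem_of_not_mem (hvI j) (htI i)).symm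
  have hv_ne (i j : Fin 3) (hij : i ≠ j) : v i ≠ v j :=
    fun h ↦ (hv i i).mp (h ▸ (hv j i).mpr hij) rfl
  have ht_w (i : Fin 3) : t i ≠ w := fun h ↦ hw ⟨i, h⟩
  have ht_ne (i j : Fin 3) (hij : i ≠ j) : t i ≠ t j := (ht i j hij).ne
  refine fromEdgeSet_isContained (f := ![t 0, t 1, t 2, v 2, v 1, v 0, w])
    (List.nodup_ofFn.mp ?_) ?_
  · simp [ht_ne, hvt, hv_ne, (hvw _).ne, ht_w]
  · simp [ht, hv, (hvw _).symm]

theorem isContained_of_isIndepSet [Finite V] (hG : ¬ G.Colorable 3) (hI : G.IsIndepSet I)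
    (hcard : Iᶜ.ncard = 4) :
    ¬ G.CliqueFree 4 ∨ (cycleGraph 5).addSimplicial 1 ⊑ G ∨ cappedSun ⊑ G := by
  rw [or_iff_not_imp_left, not_not]
  intro hK
  obtain ⟨t, w, ht, hw, hIc⟩ := exists_triangle_of_isIndepSet hG hI hcard
  by_cases hwt : ∃ i, G.Adj w (t i)
  · obtain ⟨i, hwi⟩ := hwt
    exact .inl (cycleGraph_five_addSimplicial_one_isContained_of_adj hG hK hI ht hw hIc hwi)
  · exact .inr (cappedSun_isContained_of_forall_not_adj hG hK hI ht hw hIc (not_exists.mp hwt))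

end IndependentTriple

section TriangleFree

variable {H : SimpleGraph V}

lemma card_le_mul_of_colorable_of_indepSetFree [Finite V] {m n : ℕ} (hm : H.Colorable m)
    (hn : H.IndepSetFree (n + 1)) : Nat.card V ≤ m * n := by
  classical
  have := Fintype.ofFinite V
  obtain ⟨c⟩ := hm
  by_contra! hcard
  obtain ⟨a, ha⟩ := Fintype.exists_lt_card_fiber_of_mul_lt_card c (n := n)
    (by simpa [Nat.card_eq_fintype_card] using hcard)
  obtain ⟨s, hs, hcard_s⟩ := Finset.exists_subset_card_eq ha
  refine hn s ⟨fun u hu v hv _ huv ↦ c.valid huv ?_, hcard_s⟩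
  rw [(Finset.mem_filter.mp (hs hu)).2, (Finset.mem_filter.mp (hs hv)).2]

lemma compl_adj_add_two_of_forall_adj (hH : H.CliqueFree 3) {n : ℕ} {f : Fin (n + 3) → V}
    (hf : f.Injective) (hadj : ∀ i, H.Adj (f i) (f (i + 1))) (i : Fin (n + 3)) :
    Hᶜ.Adj (f i) (f (i + 2)) := by
  have htwo : (2 : Fin (n + 3)) ≠ 0 := Fin.ne_of_val_ne (by simp [Nat.mod_eq_of_lt])
  refine ⟨hf.ne (by simpa using htwo), not_adj_of_cliqueFree_three hH (hadj i) ?_⟩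
  have hone : (1 : Fin (n + 3)) + 1 = 2 := Fin.ext (by simp [Fin.val_add])
  simpa only [add_assoc, hone] using hadj (i + 1)

lemma moserSpindle_isContained_compl_of_seven_cycle (hH : H.CliqueFree 3)
    (h5 : ¬ cycleGraph 5 ⊑ H) {f : Fin 7 → V} (hf : f.Injective)
    (hadj : ∀ i, H.Adj (f i) (f (i + 1))) : moserSpindle ⊑ Hᶜ := by
  have htwo := compl_adj_add_two_of_forall_adj hH hf hadj
  have hthree (i : Fin 7) : Hᶜ.Adj (f i) (f (i + 3)) := by
    refine ⟨hf.ne (by simp), fun h ↦ h5 ?_⟩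
    refine cycleGraph_isContained_of_adj (f := f ∘ ![i, i + 3, i + 4, i + 5, i + 6])
      (hf.comp (List.nodup_ofFn.mp (by simp))) ?_
    have hadj' (j k : Fin 7) (hjk : j + 1 = k) : H.Adj (f j) (f k) := hjk ▸ hadj j
    have hback : H.Adj (f (i + 6)) (f i) := hadj' _ _ (by grind)
    simp [Fin.forall_fin_succ, h, hback, hadj', add_assoc]
  refine fromEdgeSet_isContained (f := f ∘ ![0, 3, 5, 2, 4, 1, 6])
    (hf.comp (by decide)) ?_
  have hcompl (i j : Fin 7) (hij : i + 2 = j ∨ i + 3 = j ∨ j + 2 = i ∨ j + 3 = i) :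
      Hᶜ.Adj (f i) (f j) := by
    rcases hij with rfl | rfl | rfl | rfl
    exacts [htwo _, hthree _, (htwo _).symm, (hthree _).symm]
  simp [hcompl, -compl_adj]

lemma exists_subset_of_disjoint_of_forall_add_one_notMem (P Q : Finset (Fin 5))
    (hP : ∀ i ∈ P, i + 1 ∉ P) (hQ : ∀ i ∈ Q, i + 1 ∉ Q) (hPQ : Disjoint P Q) :
    ∃ i, (P ⊆ {i, i + 2} ∧ Q ⊆ {i + 1, i + 4}) ∨ (Q ⊆ {i, i + 2} ∧ P ⊆ {i + 1, i + 4}) := by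
  decide +revert

lemma moserSpindle_isContained_compl_of_adj_imp (hH : H.CliqueFree 3) {f : Fin 5 → V}
    (hf : f.Injective) (hadj : ∀ i, H.Adj (f i) (f (i + 1))) {p q : V} (hp : p ∉ Set.range f)
    (hq : q ∉ Set.range f) (hpq : p ≠ q) {i : Fin 5}
    (hpi : ∀ j, H.Adj p (f j) → j = i ∨ j = i + 2)
    (hqi : ∀ j, H.Adj q (f j) → j = i + 1 ∨ j = i + 4) : moserSpindle ⊑ Hᶜ := by
  have hchord := compl_adj_add_two_of_forall_adj hH hf hadj
  have hcompl (j k : Fin 5) (hjk : j + 2 = k ∨ k + 2 = j) : Hᶜ.Adj (f j) (f k) := by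
    rcases hjk with rfl | rfl
    exacts [hchord j, (hchord k).symm]
  have hp_ne (j : Fin 5) : p ≠ f j := fun h ↦ hp ⟨j, h.symm⟩
  have hq_ne (j : Fin 5) : q ≠ f j := fun h ↦ hq ⟨j, h.symm⟩
  have hp' (j : Fin 5) (hj : ¬ (j = i ∨ j = i + 2)) : Hᶜ.Adj p (f j) := ⟨hp_ne j, mt (hpi j) hj⟩
  have hq' (j : Fin 5) (hj : ¬ (j = i + 1 ∨ j = i + 4)) : Hᶜ.Adj q (f j) :=
    ⟨hq_ne j, mt (hqi j) hj⟩
  refine fromEdgeSet_isContained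
    (f := ![f (i + 3), f (i + 1), p, f i, q, f (i + 4), f (i + 2)]) (List.nodup_ofFn.mp ?_) ?_
  · simp [hf.eq_iff, hp_ne, hq_ne, hpq, (hp_ne _).symm, (hq_ne _).symm]
  · simp [hcompl, hp', (hp' _ _).symm, hq', (hq' _ _).symm, add_assoc, -compl_adj]

lemma moserSpindle_isContained_compl_of_five_cycle (hH : H.CliqueFree 3) (hI : H.IndepSetFree 4)
    {f : Fin 5 → V} (hf : f.Injective) (hadj : ∀ i, H.Adj (f i) (f (i + 1))) {p q : V}
    (hp : p ∉ Set.range f) (hq : q ∉ Set.range f) (hpq : p ≠ q) : moserSpindle ⊑ Hᶜ := by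
  classical
  have hchord := compl_adj_add_two_of_forall_adj hH hf hadj
  have hconsec (x : V) (i : Fin 5) (hx : H.Adj x (f i)) : ¬ H.Adj x (f (i + 1)) :=
    not_adj_of_cliqueFree_three hH hx (hadj i)
  have hdisj (i : Fin 5) (hpi : H.Adj p (f i)) (hqi : H.Adj q (f i)) : False := by
    have hnext (x : V) (hx : x ∉ Set.range f) (hxi : H.Adj x (f i)) :
        Hᶜ.Adj x (f (i + 1)) ∧ Hᶜ.Adj x (f (i + 4)) := by
      refine ⟨⟨fun h ↦ hx ⟨_, h.symm⟩, hconsec x i hxi⟩, fun h ↦ hx ⟨_, h.symm⟩, fun h ↦ ?_⟩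
      exact hconsec x (i + 4) h (by simpa [add_assoc] using hxi)
    have hpq' : Hᶜ.Adj p q :=
      ⟨hpq, fun h ↦ not_adj_of_cliqueFree_three hH h hqi hpi⟩
    have hneighbors : Hᶜ.Adj (f (i + 1)) (f (i + 4)) := by
      simpa [add_assoc] using (hchord (i + 4)).symm
    exact not_cliqueFree_four_of_adj hpq' (hnext p hp hpi).1 (hnext p hp hpi).2
      (hnext q hq hqi).1 (hnext q hq hqi).2 hneighbors ((cliqueFree_compl H).mpr hI)
  obtain ⟨i, h | h⟩ := exists_subset_of_disjoint_of_forall_add_one_notMem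
    {i | H.Adj p (f i)} {i | H.Adj q (f i)} (by simpa using hconsec p) (by simpa using hconsec q)
    (Finset.disjoint_filter.mpr fun i _ ↦ hdisj i)
  · exact moserSpindle_isContained_compl_of_adj_imp hH hf hadj hp hq hpq (i := i)
      (by simpa [Finset.subset_iff] using h.1) (by simpa [Finset.subset_iff] using h.2)
  · exact moserSpindle_isContained_compl_of_adj_imp hH hf hadj hq hp hpq.symm (i := i)
      (by simpa [Finset.subset_iff] using h.1) (by simpa [Finset.subset_iff] using h.2)

lemma exists_cycleGraph_isContained [Finite V] (hH : H.CliqueFree 3) (hI : H.IndepSetFree 4)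
    (hV : Nat.card V = 7) : cycleGraph 5 ⊑ H ∨ cycleGraph 7 ⊑ H := by
  obtain ⟨n, hodd, hn, hcycle⟩ := exists_odd_cycleGraph_isContained (G := H) fun h2 ↦ by
    simpa [hV] using card_le_mul_of_colorable_of_indepSetFree h2 hI
  have hle : n ≤ 7 := by
    obtain ⟨f⟩ := hcycle
    simpa [hV] using Nat.card_le_card_of_injective _ f.injective
  have hne : n ≠ 3 := by
    rintro rfl
    rw [cycleGraph_three_eq_top] at hcycle
    exact hcycle.not_cliqueFree hH
  obtain rfl | rfl : n = 5 ∨ n = 7 := by grind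
  exacts [.inl hcycle, .inr hcycle]

theorem moserSpindle_isContained_compl [Finite V] (hH : H.CliqueFree 3) (hI : H.IndepSetFree 4)
    (hV : Nat.card V = 7) : moserSpindle ⊑ Hᶜ := by
  by_cases h5 : cycleGraph 5 ⊑ H
  · obtain ⟨f⟩ := h5
    obtain ⟨p, q, hpq, hrange⟩ : ∃ p q, p ≠ q ∧ (Set.range f)ᶜ = {p, q} := by
      have hcard : (Set.range f).ncard = 5 := by
        simpa using Set.ncard_range_of_injective f.injective
      rw [← Set.ncard_eq_two, Set.ncard_compl, hV, hcard]
    have hp : p ∈ (Set.range f)ᶜ := by simp [hrange]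
    have hq : q ∈ (Set.range f)ᶜ := by simp [hrange]
    exact moserSpindle_isContained_compl_of_five_cycle hH hI f.injective
      (fun i ↦ f.toHom.map_rel (by simp [cycleGraph_adj])) hp hq hpq
  · obtain ⟨f⟩ := (exists_cycleGraph_isContained hH hI hV).resolve_left h5
    exact moserSpindle_isContained_compl_of_seven_cycle hH h5 f.injective
      (fun i ↦ f.toHom.map_rel (by simp [cycleGraph_adj]))

end TriangleFree

theorem isContained_of_not_colorable_three [Finite V] (hV : Nat.card V = 7)
    (hG : ¬ G.Colorable 3) :
    ¬ G.CliqueFree 4 ∨ (cycleGraph 5).addSimplicial 1 ⊑ G ∨ cappedSun ⊑ G ∨ moserSpindle ⊑ G := by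
  classical
  by_cases hI : G.IndepSetFree 3
  · by_cases hK : G.CliqueFree 4
    · have hM := moserSpindle_isContained_compl (H := Gᶜ) ((cliqueFree_compl G).mpr hI)
        ((indepSetFree_compl G).mpr hK) hV
      rw [compl_compl] at hM
      exact .inr (.inr (.inr hM))
    · exact .inl hK
  · obtain ⟨I, hIind, hIcard⟩ : ∃ I : Finset V, G.IsNIndepSet 3 I := by
      simpa [IndepSetFree] using hI
    have hcompl : (I : Set V)ᶜ.ncard = 4 := by
      rw [Set.ncard_compl, Set.ncard_coe_finset, hV, hIcard]
    rcases isContained_of_isIndepSet hG hIind hcompl with h | h | h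
    exacts [.inl h, .inr (.inl h), .inr (.inr (.inl h))]

end SevenVertices

section FourCritical

variable {V : Type*} {G : SimpleGraph V}

instance : DecidableRel moserSpindle.Adj := by
  unfold moserSpindle
  infer_instance

instance : DecidableRel cappedSun.Adj := by
  unfold cappedSun
  infer_instance

lemma coloring_eq_of_rhombus (c : G.Coloring (Fin 3)) {u v x y : V} (hux : G.Adj u x)
    (huy : G.Adj u y) (hxy : G.Adj x y) (hvx : G.Adj v x) (hvy : G.Adj v y) : c u = c v := by
  have := c.valid hux
  have := c.valid huy
  have := c.valid hxy
  have := c.valid hvx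
  have := c.valid hvy
  grind

lemma not_colorable_moserSpindle : ¬ moserSpindle.Colorable 3 := by
  rintro ⟨c⟩
  have h05 : c 0 = c 5 := coloring_eq_of_rhombus c (x := 1) (y := 2) (by decide) (by decide)
    (by decide) (by decide) (by decide)
  have h06 : c 0 = c 6 := coloring_eq_of_rhombus c (x := 3) (y := 4) (by decide) (by decide)
    (by decide) (by decide) (by decide)
  exact c.valid (v := 5) (w := 6) (by decide) (h05.symm.trans h06)

lemma not_colorable_cappedSun : ¬ cappedSun.Colorable 3 := by
  rintro ⟨c⟩
  have h23 : c 2 = c 3 := coloring_eq_of_rhombus c (x := 0) (y := 1) (by decide) (by decide)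
    (by decide) (by decide) (by decide)
  have h14 : c 1 = c 4 := coloring_eq_of_rhombus c (x := 0) (y := 2) (by decide) (by decide)
    (by decide) (by decide) (by decide)
  have h05 : c 0 = c 5 := coloring_eq_of_rhombus c (x := 1) (y := 2) (by decide) (by decide)
    (by decide) (by decide) (by decide)
  have h06 : c 0 ≠ c 6 := h05 ▸ c.valid (v := 5) (w := 6) (by decide)
  have h16 : c 1 ≠ c 6 := h14 ▸ c.valid (v := 4) (w := 6) (by decide)
  have h26 : c 2 ≠ c 6 := h23 ▸ c.valid (v := 3) (w := 6) (by decide)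
  have h01 : c 0 ≠ c 1 := c.valid (by decide)
  have h02 : c 0 ≠ c 2 := c.valid (by decide)
  have h12 : c 1 ≠ c 2 := c.valid (by decide)
  grind

lemma colorable_deleteEdges_of_forall {k : ℕ} {a b : V} (c : V → Fin k)
    (hc : ∀ x y, G.Adj x y → s(x, y) ≠ s(a, b) → c x ≠ c y) :
    (G.deleteEdges {s(a, b)}).Colorable k :=
  ⟨Coloring.mk c fun hxy ↦ hc _ _ (deleteEdges_adj.mp hxy).1 (deleteEdges_adj.mp hxy).2⟩

-- The colourings here and for `cappedSun` follow the order of the edges in the definitions.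
theorem isColorCritical_moserSpindle : moserSpindle.IsColorCritical 4 := by
  refine isColorCritical_succ_of_forall_adj not_colorable_moserSpindle (by decide)
    fun a b hab ↦ ?_
  obtain ⟨c, hc⟩ : ∃ c : Fin 7 → Fin 3,
      ∀ x y, moserSpindle.Adj x y → s(x, y) ≠ s(a, b) → c x ≠ c y := by
    have hmem := ((fromEdgeSet_adj _).mp hab).1
    revert hmem
    generalize s(a, b) = e
    rintro (rfl | rfl | rfl | rfl | rfl | rfl | rfl | rfl | rfl | rfl | rfl)
    · exact ⟨![0, 0, 1, 1, 2, 2, 0], by decide⟩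
    · exact ⟨![0, 1, 0, 1, 2, 2, 0], by decide⟩
    · exact ⟨![0, 1, 1, 1, 2, 2, 0], by decide⟩
    · exact ⟨![0, 1, 2, 1, 2, 1, 0], by decide⟩
    · exact ⟨![0, 1, 2, 1, 2, 2, 0], by decide⟩
    · exact ⟨![0, 1, 2, 0, 1, 0, 2], by decide⟩
    · exact ⟨![0, 1, 2, 1, 0, 0, 2], by decide⟩
    · exact ⟨![0, 1, 2, 1, 1, 0, 2], by decide⟩
    · exact ⟨![0, 1, 2, 1, 2, 0, 1], by decide⟩
    · exact ⟨![0, 1, 2, 1, 2, 0, 2], by decide⟩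
    · exact ⟨![0, 1, 2, 1, 2, 0, 0], by decide⟩
  exact colorable_deleteEdges_of_forall c hc

theorem isColorCritical_cappedSun : cappedSun.IsColorCritical 4 := by
  refine isColorCritical_succ_of_forall_adj not_colorable_cappedSun (by decide)
    fun a b hab ↦ ?_
  obtain ⟨c, hc⟩ : ∃ c : Fin 7 → Fin 3,
      ∀ x y, cappedSun.Adj x y → s(x, y) ≠ s(a, b) → c x ≠ c y := by
    have hmem := ((fromEdgeSet_adj _).mp hab).1
    revert hmem
    generalize s(a, b) = e
    rintro (rfl | rfl | rfl | rfl | rfl | rfl | rfl | rfl | rfl | rfl | rfl | rfl)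
    · exact ⟨![0, 0, 1, 1, 2, 2, 0], by decide⟩
    · exact ⟨![0, 1, 0, 2, 1, 2, 0], by decide⟩
    · exact ⟨![0, 1, 1, 2, 2, 0, 1], by decide⟩
    · exact ⟨![0, 1, 2, 0, 1, 0, 2], by decide⟩
    · exact ⟨![0, 1, 2, 1, 1, 0, 2], by decide⟩
    · exact ⟨![0, 1, 2, 2, 0, 0, 1], by decide⟩
    · exact ⟨![0, 1, 2, 2, 2, 0, 1], by decide⟩
    · exact ⟨![0, 1, 2, 2, 1, 1, 0], by decide⟩
    · exact ⟨![0, 1, 2, 2, 1, 2, 0], by decide⟩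
    · exact ⟨![0, 1, 2, 2, 1, 0, 2], by decide⟩
    · exact ⟨![0, 1, 2, 2, 1, 0, 1], by decide⟩
    · exact ⟨![0, 1, 2, 2, 1, 0, 0], by decide⟩
  exact colorable_deleteEdges_of_forall c hc

lemma adj_or_adj_or_adj_addSimplicial_moserSpindle {k : ℕ} {x y z : Fin 7 ⊕ Fin k} (hxy : x ≠ y)
    (hxz : x ≠ z) (hyz : y ≠ z) : (moserSpindle.addSimplicial k).Adj x y ∨
      (moserSpindle.addSimplicial k).Adj x z ∨ (moserSpindle.addSimplicial k).Adj y z := by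
  have hM : ∀ a b c : Fin 7, a ≠ b → a ≠ c → b ≠ c →
      moserSpindle.Adj a b ∨ moserSpindle.Adj a c ∨ moserSpindle.Adj b c := by decide
  rcases x with x | x <;> rcases y with y | y <;> rcases z with z | z <;>
    simp_all [addSimplicial]

theorem isEmpty_addSimplicial_moserSpindle_iso_addSimplicial_cappedSun (k : ℕ) :
    IsEmpty (moserSpindle.addSimplicial k ≃g cappedSun.addSimplicial k) := by
  refine ⟨fun e ↦ ?_⟩
  have hadj {i j : Fin 7} (hij : ¬ cappedSun.Adj i j) :
      ¬ (moserSpindle.addSimplicial k).Adj (e.symm (.inl i)) (e.symm (.inl j)) := by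
    rwa [e.symm.map_adj_iff, addSimplicial, joinGraph_adj_inl_inl]
  have hne {i j : Fin 7} (hij : i ≠ j) : e.symm (.inl i) ≠ e.symm (.inl j) :=
    e.symm.injective.ne (Sum.inl_injective.ne hij)
  have h34 : ¬ cappedSun.Adj 3 4 := by decide
  have h35 : ¬ cappedSun.Adj 3 5 := by decide
  have h45 : ¬ cappedSun.Adj 4 5 := by decide
  rcases adj_or_adj_or_adj_addSimplicial_moserSpindle (hne (i := 3) (j := 4) (by decide))
    (hne (j := 5) (by decide)) (hne (by decide)) with h | h | h
  exacts [hadj h34 h, hadj h35 h, hadj h45 h]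

end FourCritical

section Classification

variable {V : Type*} {G : SimpleGraph V} {k : ℕ}

lemma exists_ncard_eq_seven_of_isColorCritical [Finite V] (h : G.IsColorCritical (k + 4))
    (hV : Nat.card V = k + 7) :
    ∃ s : Set V, s.ncard = 7 ∧ ∀ v ∉ s, ∀ w, v ≠ w → G.Adj v w := by
  obtain ⟨-, hmin, hvert, -⟩ := isColorCritical_iff.mp h
  have hle : Gᶜ.support.ncard ≤ 7 := by
    refine ncard_support_compl_le (k := k + 3) (fun hc ↦ ?_) (fun v ↦ ?_) hV
    · exact absurd (hmin _ hc) (by lia)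
    · obtain ⟨m, hm, hc⟩ := hvert v
      exact hc.mono (Nat.le_of_lt_succ hm)
  obtain ⟨s, hsupp, -, hs⟩ := Set.exists_subsuperset_card_eq (Set.subset_univ _) hle
    (by rw [Set.ncard_univ]; lia)
  refine ⟨s, hs, fun v hv w hvw ↦ by_contra fun hadj ↦ hv (hsupp ?_)⟩
  exact ⟨w, hvw, hadj⟩

lemma nonempty_iso_addSimplicial_of_isContained_induce [Finite V] {W : Type*} {F : SimpleGraph W}
    (h : G.IsColorCritical (k + 4)) {s : Set V} (hs : sᶜ.ncard = k)
    (huniv : ∀ v ∉ s, ∀ w, v ≠ w → G.Adj v w) (hF : ¬ F.Colorable 3) (hFG : F ⊑ G.induce s) :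
    Nonempty (G ≃g F.addSimplicial k) := by
  subst hs
  refine nonempty_iso_of_isColorCritical h (addSimplicial_isContained hFG ?_ ?_) ?_
  · exact fun v hv w _ hvw ↦ huniv v hv w hvw
  · exact fun v hv w hw ↦ huniv v hv w (ne_of_mem_of_not_mem hw hv).symm
  · rw [add_comm]
    exact not_colorable_addSimplicial hF

lemma not_colorable_completeGraph_four : ¬ (completeGraph (Fin 4)).Colorable 3 := fun h ↦
  absurd (le_of_isColorCritical_of_colorable (isColorCritical_completeGraph 4) h) (by decide)

lemma not_colorable_addSimplicial_cycleGraph_five :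
    ¬ ((cycleGraph 5).addSimplicial 1).Colorable 3 := by
  refine not_colorable_addSimplicial fun h ↦ ?_
  have hχ := chromaticNumber_cycleGraph_of_odd 5 (by decide) (by decide)
  exact absurd (hχ ▸ chromaticNumber_le_iff_colorable.mpr h) (by decide)

lemma nonempty_iso_of_isColorCritical_add_four [Finite V] (h : G.IsColorCritical (k + 4))
    (hV : Nat.card V = k + 7) : Nonempty (G ≃g moserSpindle.addSimplicial k) ∨
      Nonempty (G ≃g cappedSun.addSimplicial k) := by
  obtain ⟨s, hs, huniv⟩ := exists_ncard_eq_seven_of_isColorCritical h hV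
  have hcompl : sᶜ.ncard = k := by rw [Set.ncard_compl, hV, hs, Nat.add_sub_cancel]
  have hind : ¬ (G.induce s).Colorable 3 := fun hc ↦ by
    have := le_of_isColorCritical_of_colorable h (colorable_add_ncard_compl hc)
    lia
  have hiso {W : Type} [Finite W] {F : SimpleGraph W} (hF : ¬ F.Colorable 3)
      (hFG : F ⊑ G.induce s) : Nonempty (G ≃g F.addSimplicial k) ∧ Nat.card W = 7 := by
    obtain ⟨e⟩ := nonempty_iso_addSimplicial_of_isContained_induce h hcompl huniv hF hFG
    refine ⟨⟨e⟩, ?_⟩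
    have hcard := Nat.card_congr e.toEquiv
    rw [Nat.card_sum, Nat.card_fin] at hcard
    lia
  rcases isContained_of_not_colorable_three ((Nat.card_coe_set_eq s).trans hs) hind
    with hK | hW | hS | hM
  · rw [not_cliqueFree_iff_top_isContained] at hK
    simpa using (hiso not_colorable_completeGraph_four hK).2
  · simpa using (hiso not_colorable_addSimplicial_cycleGraph_five hW).2
  · exact .inr (hiso not_colorable_cappedSun hS).1
  · exact .inl (hiso not_colorable_moserSpindle hM).1

theorem isColorCritical_add_four_iff [Finite V] (hV : Nat.card V = k + 7) :
    G.IsColorCritical (k + 4) ↔ Nonempty (G ≃g moserSpindle.addSimplicial k) ∨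
      Nonempty (G ≃g cappedSun.addSimplicial k) := by
  refine ⟨fun h ↦ nonempty_iso_of_isColorCritical_add_four h hV, ?_⟩
  rintro (⟨⟨e⟩⟩ | ⟨⟨e⟩⟩) <;> rw [add_comm]
  · exact isColorCritical_of_iso e (isColorCritical_addSimplicial isColorCritical_moserSpindle k)
  · exact isColorCritical_of_iso e (isColorCritical_addSimplicial isColorCritical_cappedSun k)

theorem isColorCritical_four_iff [Finite V] (hV : Nat.card V = 7) :
    G.IsColorCritical 4 ↔ Nonempty (G ≃g moserSpindle) ∨ Nonempty (G ≃g cappedSun) := by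
  obtain ⟨eM⟩ := nonempty_addSimplicial_zero_iso moserSpindle
  obtain ⟨eS⟩ := nonempty_addSimplicial_zero_iso cappedSun
  refine (isColorCritical_add_four_iff (k := 0) hV).trans (or_congr ?_ ?_)
  · exact ⟨fun ⟨e⟩ ↦ ⟨e.trans eM⟩, fun ⟨e⟩ ↦ ⟨e.trans eM.symm⟩⟩
  · exact ⟨fun ⟨e⟩ ↦ ⟨e.trans eS⟩, fun ⟨e⟩ ↦ ⟨e.trans eS.symm⟩⟩

theorem isEmpty_moserSpindle_iso_cappedSun : IsEmpty (moserSpindle ≃g cappedSun) := by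
  obtain ⟨eM⟩ := nonempty_addSimplicial_zero_iso moserSpindle
  obtain ⟨eS⟩ := nonempty_addSimplicial_zero_iso cappedSun
  refine ⟨fun e ↦ ?_⟩
  exact (isEmpty_addSimplicial_moserSpindle_iso_addSimplicial_cappedSun 0).false
    ((eM.trans e).trans eS.symm)

end Classification

end ColorCritical

theorem mainTheorem6_general (r : ℕ) (hr : 4 ≤ r) :
    (∀ (V : Type*) [Fintype V] (G : SimpleGraph V), Fintype.card V = 7 →
      (G.IsColorCritical 4 ↔
        Nonempty (G ≃g SimpleGraph.moserSpindle) ∨ Nonempty (G ≃g SimpleGraph.cappedSun))) ∧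
    IsEmpty (SimpleGraph.moserSpindle ≃g SimpleGraph.cappedSun) ∧
    (∀ (V : Type*) [Fintype V] (G : SimpleGraph V), Fintype.card V = r + 3 →
      (G.IsColorCritical r ↔
        Nonempty (G ≃g SimpleGraph.moserSpindle.addSimplicial (r - 4)) ∨
        Nonempty (G ≃g SimpleGraph.cappedSun.addSimplicial (r - 4)))) ∧
    IsEmpty (SimpleGraph.moserSpindle.addSimplicial (r - 4) ≃g
      SimpleGraph.cappedSun.addSimplicial (r - 4)) := by
  obtain ⟨k, rfl⟩ := Nat.exists_eq_add_of_le' hr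
  rw [Nat.add_sub_cancel]
  refine ⟨fun V _ G hV ↦ ColorCritical.isColorCritical_four_iff ?_,
    ColorCritical.isEmpty_moserSpindle_iso_cappedSun,
    fun V _ G hV ↦ ColorCritical.isColorCritical_add_four_iff ?_,
    ColorCritical.isEmpty_addSimplicial_moserSpindle_iso_addSimplicial_cappedSun k⟩
  · rw [Nat.card_eq_fintype_card, hV]
  · rw [Nat.card_eq_fintype_card, hV]

theorem mainTheorem6 (r : ℕ) (hr : 8 ≤ r) :
    -- up to isomorphism, the two graphs below are exactly the 4-critical graphs on 7 vertices
    (∀ (V : Type*) [Fintype V] (G : SimpleGraph V), Fintype.card V = 7 →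
      (G.IsColorCritical 4 ↔
        Nonempty (G ≃g SimpleGraph.moserSpindle) ∨ Nonempty (G ≃g SimpleGraph.cappedSun))) ∧
    IsEmpty (SimpleGraph.moserSpindle ≃g SimpleGraph.cappedSun) ∧
    -- up to isomorphism, there are exactly two r-critical graphs on r + 3 vertices, and they
    -- arise from those two graphs by adding r - 4 simplicial vertices
    (∀ (V : Type*) [Fintype V] (G : SimpleGraph V), Fintype.card V = r + 3 →
      (G.IsColorCritical r ↔
        Nonempty (G ≃g SimpleGraph.moserSpindle.addSimplicial (r - 4)) ∨
        Nonempty (G ≃g SimpleGraph.cappedSun.addSimplicial (r - 4)))) ∧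
    IsEmpty (SimpleGraph.moserSpindle.addSimplicial (r - 4) ≃g
      SimpleGraph.cappedSun.addSimplicial (r - 4)) :=
  mainTheorem6_general r (by lia)
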